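/- For every $n\ge 1$ let $x^{(n)},y^{(n)}\in\mathbb{R}^n$ be a clean signal and a noisy input (both deterministic), let $f^{(n)}:\mathbb{R}^n\to\mathbb{R}^n$ be a denoiser, and let $\tilde a^{(n)},\tilde b^{(n)},\tilde c^{(n)}$ be random vectors in $\mathbb{R}^n$ (three noisy references); the superscript $(n)$ is dropped below. Define $$\mathrm{MSE}_n:=\frac1n\sum_{i=1}^n\bigl(x_i-f(y)_i\bigr)^2,\qquad \widetilde{\mathrm{uMSE}}_n:=\frac1n\sum_{i=1}^n\Bigl(\bigl(\tilde a_i-f(y)_i\bigr)^2-\frac{(\tilde b_i-\tilde c_i)^2}{2}\Bigr).$$ Assume that for every $n$: 1. the $3n$ entries of $\tilde a,\tilde b,\tilde c$ are mutually independent; 2. $\mathbb{E}[\tilde a_i]=\mathbb{E}[\tilde b_i]=\mathbb{E}[\tilde c_i]=x_i$ for $1\le i\le n$; 3. the noise level at each entry is common to the three references: $\mathrm{Var}[\tilde a_i]=\mathrm{Var}[\tilde b_i]=\mathrm{Var}[\tilde c_i]=:\sigma_i^2$ for $1\le i\le n$. Assume further that the first six central moments of $\tilde a_i,\tilde b_i,\tilde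 c_i$ exist and are bounded by a constant independent of $i$ and $n$, that the maximum entrywise denoising error $\max_{1\le i\le n}|x_i-f(y)_i|$ is bounded by a constant independent of $n$, and that the noise does not vanish asymptotically: there is $\delta>0$ such that $\frac1n\sum_{i=1}^n\sigma_i^2\ge\delta$ for all sufficiently large $n$. Then the uMSE is asymptotically normally distributed: as $n\to\infty$, $$\frac{\widetilde{\mathrm{uMSE}}_n-\mathrm{MSE}_n}{\sqrt{\mathrm{Var}\bigl[\widetilde{\mathrm{uMSE}}_n\bigr]}}$$ converges in distribution to a standard Gaussian random variable. -/

import Mathlib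

open MeasureTheory ProbabilityTheory Filter Topology

namespace UnsupervisedMetrics

/-- Squared error of the denoiser `f` at entry `i`, for the clean signal `x` and the noisy input `y`. -/
noncomputable def SE {n : ℕ} (f : (Fin n → ℝ) → (Fin n → ℝ)) (x y : Fin n → ℝ) (i : Fin n) : ℝ :=
  (x i - f y i) ^ 2

/-- Mean squared error between the clean signal `x` and its estimate `f y`. -/
noncomputable def MSE {n : ℕ} (f : (Fin n → ℝ) → (Fin n → ℝ)) (x y : Fin n → ℝ) : ℝ :=
  (1 / (n : ℝ)) * ∑ i, SE f x y i

/-- Unsupervised squared error of the denoiser `f` at entry `i`, computed from the noisy input `y`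
and three noisy references `a`, `b`, `c`. -/
noncomputable def uSE {n : ℕ} (f : (Fin n → ℝ) → (Fin n → ℝ)) (y a b c : Fin n → ℝ) (i : Fin n) :
    ℝ :=
  (a i - f y i) ^ 2 - (b i - c i) ^ 2 / 2

/-- Unsupervised mean squared error. -/
noncomputable def uMSE {n : ℕ} (f : (Fin n → ℝ) → (Fin n → ℝ)) (y a b c : Fin n → ℝ) : ℝ :=
  (1 / (n : ℝ)) * ∑ i, uSE f y a b c i

/-- The uMSE of random references: `a i`, `b i`, `c i` are the random entries. -/
noncomputable def randomUMSE {Ω : Type*} {n : ℕ} (f : (Fin n → ℝ) → (Fin n → ℝ)) (y : Fin n → ℝ)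
    (a b c : Fin n → Ω → ℝ) : Ω → ℝ :=
  fun ω => uMSE f y (fun i => a i ω) (fun i => b i ω) (fun i => c i ω)

/-- Independence: the `3 * n` entries of the three references are all mutually independent. -/
def MutuallyIndependent {Ω : Type*} [MeasurableSpace Ω] {n : ℕ} (P : Measure Ω)
    (a b c : Fin n → Ω → ℝ) : Prop :=
  iIndepFun (Sum.elim a (Sum.elim b c)) P

/-- Centered noise: every entry of each reference is integrable, with mean the corresponding entry
of the clean signal `x`. -/
def CenteredNoise {Ω : Type*} [MeasurableSpace Ω] {n : ℕ} (P : Measure Ω) (x : Fin n → ℝ)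
    (a b c : Fin n → Ω → ℝ) : Prop :=
  ∀ i, (Integrable (a i) P ∧ ∫ ω, a i ω ∂P = x i) ∧
    (Integrable (b i) P ∧ ∫ ω, b i ω ∂P = x i) ∧
    (Integrable (c i) P ∧ ∫ ω, c i ω ∂P = x i)

/-- The first six central moments of `X` exist and are bounded by `η` in absolute value. -/
def CentralMomentsBoundedBy {Ω : Type*} [MeasurableSpace Ω] (P : Measure Ω) (X : Ω → ℝ) (η : ℝ) :
    Prop :=
  MemLp X 6 P ∧ ∀ k ∈ Finset.Icc 1 6, |centralMoment X k P| ≤ η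

end UnsupervisedMetrics

/-! With `A`, `B`, `C` the centered references at an entry and `d` the denoising error there, `n
(uMSE - MSE)` is the sum over entries of the independent variables `N = A² + 2dA - (B - C)²/2`
(`entryNoise`). Each has mean `σ² - (σ² + σ²)/2 = 0`, so a central limit theorem for triangular
arrays applies once Lyapunov's condition holds.

Sixth moments and the bound on `d` keep `E|N|³` below a constant, so the third moments sum to
`O(n)`. For the variance, the term `BC` of `N` is uncorrelated with the rest and has second moment
`σ⁴`, whence `Var N ≥ σ⁴` (`sq_integral_sq_le_variance_entryNoise`). By Cauchy–Schwarz the variances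
sum to at least `n δ²`, and the Lyapunov ratio is `O(n^(-1/2))`.

Lyapunov's theorem itself is proved by replacing characteristic functions one factor at a time by
Gaussian ones of equal variance (`norm_charFun_sub_exp_le`). -/

section CharFunBounds

/-! ### Comparison of characteristic functions with Gaussian ones. -/

lemma Finset.norm_prod_sub_prod_le {ι R : Type*} [NormedCommRing R] [NormOneClass R]
    (s : Finset ι) {f g : ι → R} (hf : ∀ i ∈ s, ‖f i‖ ≤ 1) (hg : ∀ i ∈ s, ‖g i‖ ≤ 1) :
    ‖∏ i ∈ s, f i - ∏ i ∈ s, g i‖ ≤ ∑ i ∈ s, ‖f i - g i‖ := by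
  classical
  induction s using Finset.induction with
  | empty => simp
  | insert i s hi ih =>
    rw [Finset.prod_insert hi, Finset.prod_insert hi, Finset.sum_insert hi]
    have ih' := ih (fun j hj ↦ hf j (Finset.mem_insert_of_mem hj))
      (fun j hj ↦ hg j (Finset.mem_insert_of_mem hj))
    have hfs : ‖∏ j ∈ s, f j‖ ≤ 1 := (s.norm_prod_le f).trans <|
      Finset.prod_le_one (fun _ _ ↦ norm_nonneg _) fun j hj ↦ hf j (Finset.mem_insert_of_mem hj)
    calc ‖f i * ∏ j ∈ s, f j - g i * ∏ j ∈ s, g j‖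
        = ‖(f i - g i) * ∏ j ∈ s, f j + g i * (∏ j ∈ s, f j - ∏ j ∈ s, g j)‖ := by ring_nf
      _ ≤ ‖f i - g i‖ * ‖∏ j ∈ s, f j‖ + ‖g i‖ * ‖∏ j ∈ s, f j - ∏ j ∈ s, g j‖ :=
          (norm_add_le _ _).trans (add_le_add (norm_mul_le _ _) (norm_mul_le _ _))
      _ ≤ ‖f i - g i‖ * 1 + 1 * ∑ j ∈ s, ‖f j - g j‖ := by
          gcongr
          exact hg i (Finset.mem_insert_self i s)
      _ = _ := by ring

lemma Complex.norm_exp_mul_I_sub_taylor_two_le (x : ℝ) :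
    ‖Complex.exp (x * Complex.I) - (1 + x * Complex.I - x ^ 2 / 2)‖ ≤ 4 * |x| ^ 3 := by
  rcases le_total |x| 1 with hx | hx
  · have h := Complex.exp_bound (x := x * Complex.I) (by simpa using hx) (n := 3) (by norm_num)
    have hsum : ∑ m ∈ Finset.range 3, ((x : ℂ) * Complex.I) ^ m / (m.factorial : ℂ)
        = 1 + x * Complex.I - x ^ 2 / 2 := by
      simp [Finset.sum_range_succ, mul_pow, Nat.factorial]
      ring
    rw [hsum] at h
    refine h.trans ?_
    have : 0 ≤ |x| ^ 3 := by positivity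
    simp only [Complex.norm_mul, Complex.norm_real, Real.norm_eq_abs, Complex.norm_I, mul_one]
    norm_num [Nat.factorial]
    linarith
  -- Away from the origin the triangle inequality suffices: `1 + 1 + |x| + |x|²/2 ≤ 4|x|³` when `|x|
  -- ≥ 1`.
  · have h1 : ‖Complex.exp (x * Complex.I)‖ = 1 := Complex.norm_exp_ofReal_mul_I x
    have h2 : ‖(1 + x * Complex.I - x ^ 2 / 2 : ℂ)‖ ≤ 1 + |x| + |x| ^ 2 / 2 := by
      refine (norm_sub_le _ _).trans ?_
      refine (add_le_add_left (norm_add_le _ _) _).trans (le_of_eq ?_)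
      simp
    have h3 : |x| ≤ |x| ^ 3 := le_self_pow₀ hx (by norm_num)
    have h4 : |x| ^ 2 ≤ |x| ^ 3 := pow_le_pow_right₀ hx (by norm_num)
    have h5 := norm_sub_le (Complex.exp (x * Complex.I)) (1 + x * Complex.I - x ^ 2 / 2)
    linarith

lemma Real.abs_exp_neg_half_sq_sub_le {w : ℝ} (hw : 0 ≤ w) :
    |Real.exp (-(w ^ 2 / 2)) - (1 - w ^ 2 / 2)| ≤ w ^ 3 := by
  rcases le_total w 1 with h | h
  · have h2 : w ^ 2 ≤ 1 := pow_le_one₀ hw h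
    have := Real.abs_exp_sub_one_sub_id_le (x := -(w ^ 2 / 2))
      (by rw [abs_neg, abs_of_nonneg (by positivity)]; linarith)
    have h4 : w ^ 4 ≤ w ^ 3 := pow_le_pow_of_le_one hw h (by norm_num)
    have h3 : 0 ≤ w ^ 3 := by positivity
    rw [show Real.exp (-(w ^ 2 / 2)) - (1 - w ^ 2 / 2)
      = Real.exp (-(w ^ 2 / 2)) - 1 - -(w ^ 2 / 2) by ring]
    refine this.trans ?_
    nlinarith
  · have h1 : Real.exp (-(w ^ 2 / 2)) ≤ 1 := Real.exp_le_one_iff.2 (by nlinarith)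
    have h2 := Real.add_one_le_exp (-(w ^ 2 / 2))
    have h3 : w ^ 2 ≤ w ^ 3 := pow_le_pow_right₀ h (by norm_num)
    have h4 := Real.exp_pos (-(w ^ 2 / 2))
    rw [abs_le]
    constructor <;> nlinarith

variable {Ω : Type*} [MeasurableSpace Ω] {P : Measure Ω} [IsProbabilityMeasure P] {X : Ω → ℝ}

/-- The power-mean inequality between the second and the third absolute moment. -/
lemma ProbabilityTheory.sqrt_variance_pow_three_le (hX : MemLp X 3 P) (h0 : ∫ ω, X ω ∂P = 0) :
    √(variance X P) ^ 3 ≤ ∫ ω, |X ω| ^ 3 ∂P := by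
  have hX2 : MemLp X 2 P := hX.mono_exponent (by norm_num)
  have hv : variance X P = ∫ ω, X ω ^ 2 ∂P := variance_of_integral_eq_zero hX.aemeasurable h0
  set m := √(variance X P) with hm
  have hm0 : 0 ≤ m := Real.sqrt_nonneg _
  have hmv : m ^ 2 = ∫ ω, X ω ^ 2 ∂P := by rw [hm, Real.sq_sqrt (variance_nonneg _ _), hv]
  have i3 : Integrable (fun ω ↦ |X ω| ^ 3) P := hX.integrable_norm_pow (p := 3) (by norm_num)
  -- AM-GM for `|X|³, |X|³, m³`; the difference of the two sides is `(2|X| + m)(|X| - m)²`.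
  have key : ∫ ω, 3 * m * X ω ^ 2 ∂P ≤ ∫ ω, (2 * |X ω| ^ 3 + m ^ 3) ∂P := by
    refine integral_mono (hX2.integrable_sq.const_mul _)
      ((i3.const_mul _).add (integrable_const _)) fun ω ↦ ?_
    have := abs_nonneg (X ω)
    change 3 * m * X ω ^ 2 ≤ 2 * |X ω| ^ 3 + m ^ 3
    rw [← sq_abs (X ω)]
    nlinarith [mul_nonneg (by positivity : 0 ≤ 2 * |X ω| + m) (sq_nonneg (|X ω| - m))]
  rw [integral_const_mul, integral_add (i3.const_mul _) (integrable_const _), integral_const_mul,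
    ← hmv] at key
  simp only [integral_const, probReal_univ, smul_eq_mul, one_mul] at key
  nlinarith

/-- Both terms are compared with `1 - Var X · u²/2`. The Taylor error of `X` contributes the
constant 4; the Gaussian error, in `√(Var X)³`, contributes 1 by the power-mean inequality. -/
lemma ProbabilityTheory.norm_charFun_sub_exp_le (hX : MemLp X 3 P) (h0 : ∫ ω, X ω ∂P = 0) (u : ℝ) :
    ‖charFun (P.map X) u - Complex.exp (-(variance X P * u ^ 2 / 2))‖
      ≤ 5 * |u| ^ 3 * ∫ ω, |X ω| ^ 3 ∂P := by
  have hX2 : MemLp X 2 P := hX.mono_exponent (by norm_num)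
  have hX1 : Integrable X P := hX.integrable (by norm_num)
  have hv : variance X P = ∫ ω, X ω ^ 2 ∂P := variance_of_integral_eq_zero hX.aemeasurable h0
  have i3 : Integrable (fun ω ↦ |X ω| ^ 3) P := hX.integrable_norm_pow (p := 3) (by norm_num)
  have hm := sqrt_variance_pow_three_le hX h0
  have iexp : Integrable (fun ω ↦ Complex.exp ((u * X ω : ℝ) * Complex.I)) P := by
    refine Integrable.of_bound (C := 1) ?_ (ae_of_all _ fun ω ↦ ?_)
    · have := hX.aestronglyMeasurable
      fun_prop
    · rw [Complex.norm_exp_ofReal_mul_I]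
  have i1 : Integrable (fun ω ↦ ((u * X ω : ℝ) : ℂ) * Complex.I) P :=
    ((hX1.const_mul u).ofReal (𝕜 := ℂ)).mul_const _
  have i01 : Integrable (fun ω ↦ 1 + ((u * X ω : ℝ) : ℂ) * Complex.I) P :=
    (integrable_const _).add i1
  have i2 : Integrable (fun ω ↦ ((u * X ω : ℝ) : ℂ) ^ 2 / 2) P := by
    have := ((hX2.integrable_sq.const_mul (u ^ 2 / 2)).ofReal (𝕜 := ℂ))
    refine this.congr (ae_of_all _ fun ω ↦ ?_)
    simp
    ring
  have hφ : charFun (P.map X) u = ∫ ω, Complex.exp ((u * X ω : ℝ) * Complex.I) ∂P := by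
    rw [charFun_apply_real, integral_map hX.aemeasurable (by fun_prop)]
    simp
  have htaylor : ∫ ω, (1 + ((u * X ω : ℝ) : ℂ) * Complex.I - ((u * X ω : ℝ) : ℂ) ^ 2 / 2) ∂P
      = ((1 - variance X P * u ^ 2 / 2 : ℝ) : ℂ) := by
    rw [integral_sub i01 i2, integral_add (integrable_const _) i1,
      integral_mul_const, integral_complex_ofReal, integral_const_mul, h0]
    have : ∫ ω, ((u * X ω : ℝ) : ℂ) ^ 2 / 2 ∂P = ((∫ ω, u ^ 2 / 2 * X ω ^ 2 ∂P : ℝ) : ℂ) := by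
      rw [← integral_complex_ofReal]
      congr with ω
      push_cast
      ring
    rw [this, integral_const_mul, ← hv]
    simp
    ring
  have hb1 : ‖charFun (P.map X) u - ((1 - variance X P * u ^ 2 / 2 : ℝ) : ℂ)‖
      ≤ 4 * |u| ^ 3 * ∫ ω, |X ω| ^ 3 ∂P := by
    rw [hφ, ← htaylor, ← integral_sub iexp (i01.sub' i2),
      ← integral_const_mul]
    refine norm_integral_le_of_norm_le (i3.const_mul _) (ae_of_all _ fun ω ↦ ?_)
    refine (Complex.norm_exp_mul_I_sub_taylor_two_le (u * X ω)).trans (le_of_eq ?_)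
    rw [abs_mul]
    ring
  have hb2 : ‖((1 - variance X P * u ^ 2 / 2 : ℝ) : ℂ)
      - Complex.exp (-(variance X P * u ^ 2 / 2))‖ ≤ |u| ^ 3 * ∫ ω, |X ω| ^ 3 ∂P := by
    have hw := Real.abs_exp_neg_half_sq_sub_le (w := √(variance X P) * |u|) (by positivity)
    rw [mul_pow, Real.sq_sqrt (variance_nonneg _ _), sq_abs, mul_pow] at hw
    have hcast : Complex.exp (-(variance X P * u ^ 2 / 2))
        = ((Real.exp (-(variance X P * u ^ 2 / 2)) : ℝ) : ℂ) := by push_cast; rfl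
    rw [hcast, ← Complex.ofReal_sub, Complex.norm_real, Real.norm_eq_abs, abs_sub_comm]
    refine hw.trans ?_
    rw [mul_comm]
    gcongr
  calc _ ≤ _ := norm_sub_le_norm_sub_add_norm_sub _ ((1 - variance X P * u ^ 2 / 2 : ℝ) : ℂ) _
    _ ≤ _ := add_le_add hb1 hb2
    _ = _ := by ring

end CharFunBounds

/-! ### Lyapunov's theorem and independence of blocks. -/

/-- **Lyapunov's central limit theorem** for triangular arrays, with third absolute moments. -/
theorem ProbabilityTheory.tendstoInDistribution_sum_div_sqrt_sum_variance
    {ι : ℕ → Type*} [∀ n, Fintype (ι n)] {Ω : ℕ → Type*} [∀ n, MeasurableSpace (Ω n)]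
    {P : (n : ℕ) → Measure (Ω n)} [∀ n, IsProbabilityMeasure (P n)]
    {X : (n : ℕ) → ι n → Ω n → ℝ}
    (hX : ∀ n i, MemLp (X n i) 3 (P n)) (h0 : ∀ n i, ∫ ω, X n i ω ∂(P n) = 0)
    (hindep : ∀ n, iIndepFun (X n) (P n))
    (hpos : ∀ᶠ n in atTop, 0 < ∑ i, variance (X n i) (P n))
    (hlyap : Tendsto
      (fun n ↦ (∑ i, ∫ ω, |X n i ω| ^ 3 ∂(P n)) / √(∑ i, variance (X n i) (P n)) ^ 3)
      atTop (𝓝 0)) :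
    TendstoInDistribution
      (fun n ω ↦ (∑ i, X n i ω) / √(∑ i, variance (X n i) (P n)))
      atTop (id : ℝ → ℝ) P (gaussianReal 0 1) where
  forall_aemeasurable n :=
    (Finset.aemeasurable_fun_sum _ fun i _ ↦ (hX n i).aemeasurable).div_const _
  tendsto := by
    refine ProbabilityMeasure.tendsto_iff_tendsto_charFun.2 fun t ↦ ?_
    simp only [ProbabilityMeasure.coe_mk, Measure.map_id, charFun_gaussianReal]
    rw [tendsto_iff_norm_sub_tendsto_zero]
    have hlim := hlyap.const_mul (5 * |t| ^ 3)
    rw [mul_zero] at hlim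
    refine squeeze_zero' (.of_forall fun n ↦ norm_nonneg _) ?_ hlim
    filter_upwards [hpos] with n hn
    set s := √(∑ i, variance (X n i) (P n)) with hs
    have hs0 : 0 < s := Real.sqrt_pos.2 hn
    have hs2 : s ^ 2 = ∑ i, variance (X n i) (P n) := Real.sq_sqrt hn.le
    have hφ : charFun ((P n).map fun ω ↦ (∑ i, X n i ω) / s) t
        = ∏ i, charFun ((P n).map (X n i)) (s⁻¹ * t) := by
      simp_rw [div_eq_inv_mul]
      rw [charFun_map_mul_comp
          (Finset.aemeasurable_fun_sum _ fun i _ ↦ (hX n i).aemeasurable),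
        (hindep n).charFun_map_fun_sum_eq_prod fun i ↦ (hX n i).aemeasurable]
      simp
    -- The standard Gaussian is split into independent Gaussians with the variances of the summands,
    -- to be matched factor by factor.
    have hγ : Complex.exp (t * (0 : ℝ) * Complex.I - ((1 : NNReal) : ℝ) * t ^ 2 / 2)
        = ∏ i, Complex.exp (-(variance (X n i) (P n) * ((s⁻¹ * t : ℝ) : ℂ) ^ 2 / 2)) := by
      rw [← Complex.exp_sum, Finset.sum_neg_distrib, ← Finset.sum_div, ← Finset.sum_mul,
        ← Complex.ofReal_sum, ← hs2]
      have : (s : ℂ) ≠ 0 := by exact_mod_cast hs0.ne'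
      congr 1
      push_cast
      field_simp
      simp [sq]
    rw [hφ, hγ]
    refine (Finset.univ.norm_prod_sub_prod_le (fun i _ ↦ ?_) fun i _ ↦ ?_).trans ?_
    · have := Measure.isProbabilityMeasure_map (hX n i).aemeasurable
      exact norm_charFun_le_one _
    · rw [Complex.norm_exp]
      refine Real.exp_le_one_iff.2 ?_
      have : (-(variance (X n i) (P n) * ((s⁻¹ * t : ℝ) : ℂ) ^ 2 / 2))
          = ((-(variance (X n i) (P n) * (s⁻¹ * t) ^ 2 / 2) : ℝ) : ℂ) := by push_cast; rfl
      rw [this, Complex.ofReal_re, neg_nonpos]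
      have := variance_nonneg (X n i) (P n)
      positivity
    · refine (Finset.sum_le_sum fun i _ ↦
        norm_charFun_sub_exp_le (hX n i) (h0 n i) (s⁻¹ * t)).trans (le_of_eq ?_)
      rw [← Finset.mul_sum, abs_mul, abs_inv, abs_of_pos hs0]
      field_simp

/-- Blocks of a mutually independent family are mutually independent. -/
lemma ProbabilityTheory.iIndepFun.curry {ι κ Ω β : Type*} [Fintype ι] [Fintype κ]
    [MeasurableSpace Ω] [MeasurableSpace β] {P : Measure Ω} [IsProbabilityMeasure P]
    {X : ι → κ → Ω → β} (hX : ∀ i j, AEMeasurable (X i j) P)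
    (h : iIndepFun (fun p : ι × κ ↦ X p.1 p.2) P) :
    iIndepFun (fun i ω j ↦ X i j ω) P := by
  have (i : ι) (j : κ) : IsProbabilityMeasure (P.map (X i j)) :=
    Measure.isProbabilityMeasure_map (hX i j)
  have hrow (i : ι) : iIndepFun (X i) P := h.precomp (g := Prod.mk i) (Prod.mk_right_injective i)
  rw [iIndepFun_iff_map_fun_eq_pi_map fun i ↦ aemeasurable_pi_lambda _ fun j ↦ hX i j]
  have hjoint := (iIndepFun_iff_map_fun_eq_pi_map fun p : ι × κ ↦ hX p.1 p.2).1 h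
  -- Currying turns the product law over pairs into a product of row products, each of which is the
  -- law of its row.
  have hcurry := Measure.infinitePi_map_curry (fun i j ↦ P.map (X i j))
  simp only [Measure.infinitePi_eq_pi] at hcurry
  rw [← hjoint, AEMeasurable.map_map_of_aemeasurable (by fun_prop)
    (aemeasurable_pi_lambda _ fun p : ι × κ ↦ hX p.1 p.2)] at hcurry
  simp_rw [fun i ↦ (iIndepFun_iff_map_fun_eq_pi_map (hX i)).1 (hrow i)]
  exact hcurry

/-! ### Mean, variance and third moment of the noise at one entry. -/

namespace UnsupervisedMetrics

section SingleEntry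

variable {Ω : Type*} [MeasurableSpace Ω] {P : Measure Ω} [IsProbabilityMeasure P]

omit [IsProbabilityMeasure P] in
lemma memLp_three_mul {X Y : Ω → ℝ} (hX : MemLp X 6 P) (hY : MemLp Y 6 P) :
    MemLp (fun ω ↦ X ω * Y ω) 3 P := by
  have : ENNReal.HolderTriple 6 6 3 := ⟨by
    rw [show (6 : ENNReal) = 2 * 3 by norm_num,
      ENNReal.mul_inv (by simp) (by simp), ← add_mul, ENNReal.inv_two_add_inv_two, one_mul]⟩
  exact hY.mul' hX

/-- The noise of `uSE` at an entry, with `A`, `B`, `C` the noises of the references and `d` the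
denoising error. -/
noncomputable def entryNoise (d : ℝ) (A B C : Ω → ℝ) (ω : Ω) : ℝ :=
  A ω ^ 2 + 2 * d * A ω - (B ω - C ω) ^ 2 / 2

variable {d : ℝ} {A B C : Ω → ℝ}

lemma memLp_entryNoise (hA : MemLp A 6 P) (hB : MemLp B 6 P) (hC : MemLp C 6 P) :
    MemLp (entryNoise d A B C) 3 P := by
  have h1 := memLp_three_mul hA hA
  have h2 := memLp_three_mul (hB.sub hC) (hB.sub hC)
  have h3 : MemLp A 3 P := hA.mono_exponent (by norm_num)
  have h := (h1.add (h3.const_mul (2 * d))).sub (h2.const_mul (1 / 2))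
  refine h.ae_eq (ae_of_all _ fun ω ↦ ?_)
  simp only [Pi.sub_apply, Pi.add_apply, entryNoise]
  ring

lemma integral_entryNoise (hA : MemLp A 6 P) (hB : MemLp B 6 P) (hC : MemLp C 6 P)
    (hBC : IndepFun B C P) (hA0 : ∫ ω, A ω ∂P = 0) (hB0 : ∫ ω, B ω ∂P = 0)
    (hAB : ∫ ω, B ω ^ 2 ∂P = ∫ ω, A ω ^ 2 ∂P) (hAC : ∫ ω, C ω ^ 2 ∂P = ∫ ω, A ω ^ 2 ∂P) :
    ∫ ω, entryNoise d A B C ω ∂P = 0 := by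
  have iA : Integrable A P := hA.integrable (by norm_num)
  have iA2 := (hA.mono_exponent (p := 2) (by norm_num)).integrable_sq
  have iB2 := (hB.mono_exponent (p := 2) (by norm_num)).integrable_sq
  have iC2 := (hC.mono_exponent (p := 2) (by norm_num)).integrable_sq
  have iBC := (memLp_three_mul hB hC).integrable (by norm_num)
  have hBC0 : ∫ ω, B ω * C ω ∂P = 0 := by
    rw [hBC.integral_fun_mul_eq_mul_integral hB.aestronglyMeasurable hC.aestronglyMeasurable, hB0,
      zero_mul]
  have hexp : entryNoise d A B C = fun ω ↦
      A ω ^ 2 + 2 * d * A ω - (1 / 2 * B ω ^ 2 + 1 / 2 * C ω ^ 2) + B ω * C ω := by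
    ext ω
    simp only [entryNoise]
    ring
  rw [hexp, integral_add (by fun_prop) iBC, integral_sub (by fun_prop) (by fun_prop),
    integral_add iA2 (by fun_prop), integral_add (by fun_prop) (by fun_prop), integral_const_mul,
    integral_const_mul, integral_const_mul, hA0, hAB, hAC, hBC0]
  ring

/-- The noise `N` is tested against `BC`: all products but `(BC)²` keep a lone centered factor `B`
or `C`, so `E[N·BC] = E[(BC)²] = σ⁴`, and `E[(N - BC)²] ≥ 0` concludes. The squares alone would not
do: for noise `±1` and `d = 0` they are constant and `N = BC`. -/
lemma sq_integral_sq_le_variance_entryNoise (hA : MemLp A 6 P) (hB : MemLp B 6 P)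
    (hC : MemLp C 6 P) (hind : iIndepFun ![A, B, C] P) (hA0 : ∫ ω, A ω ∂P = 0)
    (hB0 : ∫ ω, B ω ∂P = 0) (hC0 : ∫ ω, C ω ∂P = 0)
    (hAB : ∫ ω, B ω ^ 2 ∂P = ∫ ω, A ω ^ 2 ∂P) (hAC : ∫ ω, C ω ^ 2 ∂P = ∫ ω, A ω ^ 2 ∂P) :
    (∫ ω, A ω ^ 2 ∂P) ^ 2 ≤ variance (entryNoise d A B C) P := by
  have hmeas : ∀ i, AEMeasurable (![A, B, C] i) P := by
    intro i
    fin_cases i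
    exacts [hA.aemeasurable, hB.aemeasurable, hC.aemeasurable]
  have iBC : IndepFun B C P := hind.indepFun (i := 1) (j := 2) (by decide)
  have iAB_C : IndepFun (fun ω ↦ (A ω, B ω)) C P :=
    hind.indepFun_prodMk₀ hmeas 0 1 2 (by decide) (by decide)
  have mA := hA.aestronglyMeasurable
  have mB := hB.aestronglyMeasurable
  have mC := hC.aestronglyMeasurable
  have hBC2 : MemLp (fun ω ↦ B ω * C ω) 2 P :=
    (memLp_three_mul hB hC).mono_exponent (by norm_num)
  have hA2 : MemLp A 2 P := hA.mono_exponent (by norm_num)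
  have hsq {X : Ω → ℝ} (hX : MemLp X 6 P) : MemLp (fun ω ↦ X ω ^ 2) 2 P := by
    simp only [sq]
    exact (memLp_three_mul hX hX).mono_exponent (by norm_num)
  have hN : MemLp (entryNoise d A B C) 2 P :=
    (memLp_entryNoise hA hB hC).mono_exponent (by norm_num)
  have i1 : Integrable (fun ω ↦ A ω ^ 2 * (B ω * C ω)) P := (hsq hA).integrable_mul hBC2
  have i2 : Integrable (fun ω ↦ A ω * (B ω * C ω)) P := hA2.integrable_mul hBC2
  have i3 : Integrable (fun ω ↦ B ω ^ 2 * (B ω * C ω)) P := (hsq hB).integrable_mul hBC2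
  have i4 : Integrable (fun ω ↦ C ω ^ 2 * (B ω * C ω)) P := (hsq hC).integrable_mul hBC2
  have i5 : Integrable (fun ω ↦ (B ω * C ω) ^ 2) P := hBC2.integrable_sq
  have i6 : Integrable (fun ω ↦ entryNoise d A B C ω * (B ω * C ω)) P := hN.integrable_mul hBC2
  have i7 : Integrable (fun ω ↦ entryNoise d A B C ω ^ 2) P := hN.integrable_sq
  have e1 : ∫ ω, A ω ^ 2 * (B ω * C ω) ∂P = 0 := by
    have := iAB_C.integral_fun_comp_mul_comp (f := fun p : ℝ × ℝ ↦ p.1 ^ 2 * p.2)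
      (g := fun c : ℝ ↦ c) (by fun_prop) (by fun_prop) (by fun_prop) (by fun_prop)
    simpa only [mul_assoc, hC0, mul_zero] using this
  have e2 : ∫ ω, A ω * (B ω * C ω) ∂P = 0 := by
    have := iAB_C.integral_fun_comp_mul_comp (f := fun p : ℝ × ℝ ↦ p.1 * p.2)
      (g := fun c : ℝ ↦ c) (by fun_prop) (by fun_prop) (by fun_prop) (by fun_prop)
    simpa only [mul_assoc, hC0, mul_zero] using this
  have e3 : ∫ ω, B ω ^ 2 * (B ω * C ω) ∂P = 0 := by
    have := iBC.integral_fun_comp_mul_comp (f := fun b : ℝ ↦ b ^ 2 * b)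
      (g := fun c : ℝ ↦ c) (by fun_prop) (by fun_prop) (by fun_prop) (by fun_prop)
    simpa only [mul_assoc, hC0, mul_zero] using this
  have e4 : ∫ ω, C ω ^ 2 * (B ω * C ω) ∂P = 0 := by
    have := iBC.integral_fun_comp_mul_comp (f := fun b : ℝ ↦ b)
      (g := fun c : ℝ ↦ c * c ^ 2) (by fun_prop) (by fun_prop) (by fun_prop) (by fun_prop)
    rw [hB0, zero_mul] at this
    rw [← this]
    congr with ω
    ring
  have e5 : ∫ ω, (B ω * C ω) ^ 2 ∂P = (∫ ω, A ω ^ 2 ∂P) ^ 2 := by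
    have := iBC.integral_fun_comp_mul_comp (f := fun b : ℝ ↦ b ^ 2)
      (g := fun c : ℝ ↦ c ^ 2) (by fun_prop) (by fun_prop) (by fun_prop) (by fun_prop)
    rw [hAB, hAC] at this
    simp only [mul_pow]
    rw [this]
    ring
  have hcross : ∫ ω, entryNoise d A B C ω * (B ω * C ω) ∂P = (∫ ω, A ω ^ 2 ∂P) ^ 2 := by
    have hexp : (fun ω ↦ entryNoise d A B C ω * (B ω * C ω)) = fun ω ↦
        A ω ^ 2 * (B ω * C ω) + 2 * d * (A ω * (B ω * C ω))
          - (1 / 2 * (B ω ^ 2 * (B ω * C ω)) + 1 / 2 * (C ω ^ 2 * (B ω * C ω)))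
          + (B ω * C ω) ^ 2 := by
      ext ω
      simp only [entryNoise]
      ring
    have i2' := i2.const_mul (2 * d)
    have i3' := i3.const_mul (1 / 2)
    have i4' := i4.const_mul (1 / 2)
    rw [hexp, integral_add (by fun_prop) i5, integral_sub (by fun_prop) (by fun_prop),
      integral_add i1 i2', integral_add i3' i4',
      integral_const_mul, integral_const_mul, integral_const_mul, e1, e2, e3, e4, e5]
    ring
  rw [variance_of_integral_eq_zero hN.aemeasurable
    (integral_entryNoise hA hB hC iBC hA0 hB0 hAB hAC)]
  have key : ∫ ω, (2 * (entryNoise d A B C ω * (B ω * C ω)) - (B ω * C ω) ^ 2) ∂P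
      ≤ ∫ ω, entryNoise d A B C ω ^ 2 ∂P := by
    refine integral_mono ((i6.const_mul 2).sub i5) i7 fun ω ↦ ?_
    have := sq_nonneg (entryNoise d A B C ω - B ω * C ω)
    simp only
    linarith
  rw [integral_sub (i6.const_mul 2) i5, integral_const_mul, hcross, e5] at key
  linarith

omit [MeasurableSpace Ω] in
lemma abs_entryNoise_pow_three_le (ω : Ω) :
    |entryNoise d A B C ω| ^ 3 ≤ 128 * A ω ^ 6 + 16 * d ^ 6 + 16 * B ω ^ 6 + 16 * C ω ^ 6 := by
  -- From `|2dA| ≤ A² + d²` and `(B - C)²/2 ≤ B² + C²`. Applying `(u + v)³ ≤ 4(u³ + v³)` twice then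
  -- gives the factor 16, and `128 = 16 · 2³`.
  have h : |entryNoise d A B C ω| ≤ (2 * A ω ^ 2 + d ^ 2) + (B ω ^ 2 + C ω ^ 2) := by
    simp only [entryNoise]
    rw [abs_le]
    constructor <;> nlinarith [sq_nonneg (A ω + d), sq_nonneg (A ω - d), sq_nonneg (B ω + C ω),
      sq_nonneg (B ω - C ω), sq_nonneg (A ω), sq_nonneg (B ω), sq_nonneg (C ω)]
  have h1 := add_pow_le (a := 2 * A ω ^ 2 + d ^ 2) (b := B ω ^ 2 + C ω ^ 2)
    (by positivity) (by positivity) 3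
  have h2 := add_pow_le (a := 2 * A ω ^ 2) (b := d ^ 2) (by positivity) (by positivity) 3
  have h3 := add_pow_le (a := B ω ^ 2) (b := C ω ^ 2) (by positivity) (by positivity) 3
  have h0 := pow_le_pow_left₀ (abs_nonneg _) h 3
  norm_num [mul_pow, ← pow_mul] at h1 h2 h3
  linarith

lemma integral_abs_entryNoise_pow_three_le {η γ : ℝ} (hA : MemLp A 6 P) (hB : MemLp B 6 P)
    (hC : MemLp C 6 P) (hAη : ∫ ω, A ω ^ 6 ∂P ≤ η) (hBη : ∫ ω, B ω ^ 6 ∂P ≤ η)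
    (hCη : ∫ ω, C ω ^ 6 ∂P ≤ η) (hd : |d| ≤ γ) :
    ∫ ω, |entryNoise d A B C ω| ^ 3 ∂P ≤ 160 * η + 16 * γ ^ 6 := by
  have hpow {X : Ω → ℝ} (hX : MemLp X 6 P) : Integrable (fun ω ↦ X ω ^ 6) P :=
    (hX.integrable_norm_pow (p := 6) (by norm_num)).congr <| ae_of_all _ fun ω ↦ by
      simp [Real.norm_eq_abs, Even.pow_abs (show Even 6 by decide)]
  have iA := (hpow hA).const_mul 128
  have iB := (hpow hB).const_mul 16
  have iC : Integrable (fun ω ↦ 16 * C ω ^ 6) P := (hpow hC).const_mul 16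
  have iN : Integrable (fun ω ↦ |entryNoise d A B C ω| ^ 3) P :=
    (memLp_entryNoise hA hB hC).integrable_norm_pow (p := 3) (by norm_num)
  have iAd : Integrable (fun ω ↦ 128 * A ω ^ 6 + 16 * d ^ 6) P := iA.add (integrable_const _)
  have iABd : Integrable (fun ω ↦ 128 * A ω ^ 6 + 16 * d ^ 6 + 16 * B ω ^ 6) P := iAd.add iB
  have hd6 : d ^ 6 ≤ γ ^ 6 := by
    rw [← Even.pow_abs (show Even 6 by decide) d]
    exact pow_le_pow_left₀ (abs_nonneg d) hd 6
  refine (integral_mono iN (iABd.add iC) fun ω ↦ abs_entryNoise_pow_three_le ω).trans ?_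
  rw [integral_add' iABd iC, integral_add iAd iB, integral_add iA (integrable_const _)]
  simp only [integral_const_mul, integral_const, probReal_univ, smul_eq_mul, one_mul]
  linarith

end SingleEntry

end UnsupervisedMetrics

/-! ### From single entries to the uMSE: independence and normalization. -/

namespace UnsupervisedMetrics

lemma CentralMomentsBoundedBy.integral_sub_pow_six_le {Ω : Type*} [MeasurableSpace Ω]
    {P : Measure Ω} {X : Ω → ℝ} {η m : ℝ} (h : CentralMomentsBoundedBy P X η)
    (hm : ∫ ω, X ω ∂P = m) : ∫ ω, (X ω - m) ^ 6 ∂P ≤ η := by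
  have := (le_abs_self _).trans (h.2 6 (by simp))
  simpa [centralMoment, hm] using this

section Array

variable {Ω : Type*} [MeasurableSpace Ω] {n : ℕ}

/-- The centered contribution of entry `i` to `n • uMSE`. -/
noncomputable def noise (f : (Fin n → ℝ) → Fin n → ℝ) (x y : Fin n → ℝ) (a b c : Fin n → Ω → ℝ)
    (i : Fin n) : Ω → ℝ :=
  entryNoise (x i - f y i) (fun ω ↦ a i ω - x i) (fun ω ↦ b i ω - x i) (fun ω ↦ c i ω - x i)

variable {P : Measure Ω} [IsProbabilityMeasure P] {f : (Fin n → ℝ) → Fin n → ℝ}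
  {x y : Fin n → ℝ} {a b c : Fin n → Ω → ℝ}

omit [MeasurableSpace Ω] in
lemma randomUMSE_eq (ω : Ω) : randomUMSE f y a b c ω
    = (1 / (n : ℝ)) * ∑ i, noise f x y a b c i ω + MSE f x y := by
  simp only [randomUMSE, uMSE, MSE, ← mul_add, ← Finset.sum_add_distrib]
  congr! with i
  simp only [uSE, SE, noise, entryNoise]
  ring

/-- The entries are reindexed by pairs (entry, reference) and grouped by entry; the noise at an
entry is a function of its own block. -/
lemma iIndepFun_noise (hind : MutuallyIndependent P a b c) (ha : ∀ i, AEMeasurable (a i) P)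
    (hb : ∀ i, AEMeasurable (b i) P) (hc : ∀ i, AEMeasurable (c i) P) :
    iIndepFun (noise f x y a b c) P := by
  let g : Fin n × Fin 3 → Fin n ⊕ (Fin n ⊕ Fin n) := fun p ↦
    ![Sum.inl p.1, Sum.inr (Sum.inl p.1), Sum.inr (Sum.inr p.1)] p.2
  have hg : g.Injective := by
    rintro ⟨i, j⟩ ⟨i', j'⟩ h
    fin_cases j <;> fin_cases j' <;> simp_all [g]
  have hX : iIndepFun (fun p : Fin n × Fin 3 ↦ (![a p.1, b p.1, c p.1] : Fin 3 → Ω → ℝ) p.2) P := by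
    convert hind.precomp hg using 2 with p
    obtain ⟨i, j⟩ := p
    fin_cases j <;> simp [g]
  have hmeas (i : Fin n) (j : Fin 3) :
      AEMeasurable ((![a i, b i, c i] : Fin 3 → Ω → ℝ) j) P := by
    fin_cases j
    exacts [ha i, hb i, hc i]
  exact (iIndepFun.curry hmeas hX).comp
    (fun i (v : Fin 3 → ℝ) ↦ (v 0 - x i) ^ 2 + 2 * (x i - f y i) * (v 0 - x i)
      - ((v 1 - x i) - (v 2 - x i)) ^ 2 / 2) fun i ↦ by fun_prop

omit [IsProbabilityMeasure P] in
lemma iIndepFun_centered_entry (hind : MutuallyIndependent P a b c) (i : Fin n) :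
    iIndepFun ![fun ω ↦ a i ω - x i, fun ω ↦ b i ω - x i, fun ω ↦ c i ω - x i] P := by
  let g : Fin 3 → Fin n ⊕ (Fin n ⊕ Fin n) := ![Sum.inl i, Sum.inr (Sum.inl i), Sum.inr (Sum.inr i)]
  have hg : g.Injective := by
    intro j j' h
    fin_cases j <;> fin_cases j' <;> simp_all [g]
  convert (hind.precomp hg).comp (fun _ t ↦ t - x i) (fun _ ↦ by fun_prop) using 2 with j
  fin_cases j <;> simp [g] <;> rfl

lemma variance_randomUMSE (hN : ∀ i, MemLp (noise f x y a b c i) 2 P)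
    (hind : iIndepFun (noise f x y a b c) P) :
    variance (randomUMSE f y a b c) P
      = (1 / (n : ℝ)) ^ 2 * ∑ i, variance (noise f x y a b c i) P := by
  have hS : MemLp (∑ i, noise f x y a b c i) 2 P := memLp_finsetSum' _ fun i _ ↦ hN i
  have h : randomUMSE f y a b c
      = fun ω ↦ (1 / (n : ℝ)) * (∑ i, noise f x y a b c i) ω + MSE f x y := by
    ext ω
    simp [randomUMSE_eq (x := x)]
  rw [h, variance_add_const (hS.aestronglyMeasurable.const_mul _), variance_const_mul,
    IndepFun.variance_sum (fun i _ ↦ hN i) fun i _ j _ hij ↦ hind.indepFun hij]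

lemma normalized_randomUMSE_eq (hN : ∀ i, MemLp (noise f x y a b c i) 2 P)
    (hind : iIndepFun (noise f x y a b c) P) (ω : Ω) :
    (randomUMSE f y a b c ω - MSE f x y) / √(variance (randomUMSE f y a b c) P)
      = (∑ i, noise f x y a b c i ω) / √(∑ i, variance (noise f x y a b c i) P) := by
  rw [variance_randomUMSE hN hind, randomUMSE_eq (x := x), add_sub_cancel_right,
    Real.sqrt_mul (by positivity), Real.sqrt_sq (by positivity)]
  rcases Nat.eq_zero_or_pos n with rfl | hn
  · simp
  · exact mul_div_mul_left _ _ (by positivity)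

end Array

lemma integral_sub_sq_eq_variance {Ω : Type*} [MeasurableSpace Ω] {P : Measure Ω} {X : Ω → ℝ}
    {m : ℝ} (hX : AEMeasurable X P) (hm : ∫ ω, X ω ∂P = m) :
    ∫ ω, (X ω - m) ^ 2 ∂P = variance X P := by
  rw [variance_eq_integral hX, hm]

lemma integral_sub_eq_zero {Ω : Type*} [MeasurableSpace Ω] {P : Measure Ω} [IsProbabilityMeasure P]
    {X : Ω → ℝ} {m : ℝ} (hX : Integrable X P) (hm : ∫ ω, X ω ∂P = m) :
    ∫ ω, (X ω - m) ∂P = 0 := by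
  rw [integral_sub hX (integrable_const _), hm]
  simp

end UnsupervisedMetrics

/-! ### Decay of the Lyapunov ratio and conclusion. -/

lemma tendsto_div_sqrt_pow_three_of_le {r v : ℕ → ℝ} {K κ : ℝ} (hκ : 0 < κ)
    (hr0 : ∀ n, 0 ≤ r n) (hr : ∀ n, r n ≤ n * K) (hv : ∀ᶠ n : ℕ in atTop, n * κ ^ 2 ≤ v n) :
    Tendsto (fun n ↦ r n / √(v n) ^ 3) atTop (𝓝 0) := by
  have hlim : Tendsto (fun n : ℕ ↦ K / κ ^ 3 * (√(n : ℝ))⁻¹) atTop (𝓝 0) := by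
    rw [← mul_zero (K / κ ^ 3)]
    exact (tendsto_inv_atTop_zero.comp
      (Real.tendsto_sqrt_atTop.comp tendsto_natCast_atTop_atTop)).const_mul _
  refine squeeze_zero' (.of_forall fun n ↦ div_nonneg (hr0 n) (by positivity)) ?_ hlim
  filter_upwards [hv, eventually_gt_atTop 0] with n hn hn0
  have hs : 0 < √(n : ℝ) := Real.sqrt_pos.2 (by exact_mod_cast hn0)
  have hle : √(n : ℝ) * κ ≤ √(v n) := by
    refine Real.le_sqrt_of_sq_le ?_
    rwa [mul_pow, Real.sq_sqrt (by positivity)]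
  calc r n / √(v n) ^ 3 ≤ (n * K) / (√(n : ℝ) * κ) ^ 3 := by
        have := (hr0 n).trans (hr n)
        gcongr
        exact hr n
    _ = (√(n : ℝ) ^ 2 * K) / (√(n : ℝ) * κ) ^ 3 := by rw [Real.sq_sqrt (by positivity)]
    _ = K / κ ^ 3 * (√(n : ℝ))⁻¹ := by field_simp

theorem theorem3
    -- for every number of entries `n`: a probability space, a clean signal, a noisy input,
    -- a denoiser and three random references
    {Ω : ℕ → Type*} [∀ n, MeasurableSpace (Ω n)]
    (P : (n : ℕ) → Measure (Ω n)) [∀ n, IsProbabilityMeasure (P n)]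
    (x y : (n : ℕ) → Fin n → ℝ)
    (f : (n : ℕ) → (Fin n → ℝ) → (Fin n → ℝ))
    (a b c : (n : ℕ) → Fin n → Ω n → ℝ)
    -- the noise model
    (hindep : ∀ n, UnsupervisedMetrics.MutuallyIndependent (P n) (a n) (b n) (c n))
    (hcent : ∀ n, UnsupervisedMetrics.CenteredNoise (P n) (x n) (a n) (b n) (c n))
    (hvar : ∀ n i, variance (b n i) (P n) = variance (a n i) (P n) ∧
      variance (c n i) (P n) = variance (a n i) (P n))
    -- bounded central moments and bounded maximum entrywise denoising error
    (hmom : ∃ η : ℝ, ∀ n i,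
      UnsupervisedMetrics.CentralMomentsBoundedBy (P n) (a n i) η ∧
      UnsupervisedMetrics.CentralMomentsBoundedBy (P n) (b n i) η ∧
      UnsupervisedMetrics.CentralMomentsBoundedBy (P n) (c n i) η)
    (herr : ∃ γ : ℝ, ∀ n i, |x n i - f n (y n) i| ≤ γ)
    -- the noise does not vanish asymptotically
    (hnondeg : ∃ δ : ℝ, 0 < δ ∧ ∀ᶠ n : ℕ in atTop,
      δ ≤ (1 / (n : ℝ)) * ∑ i, variance (a n i) (P n)) :
    TendstoInDistribution
      (fun n ω =>
        (UnsupervisedMetrics.randomUMSE (f n) (y n) (a n) (b n) (c n) ω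
            - UnsupervisedMetrics.MSE (f n) (x n) (y n))
          / √(variance (UnsupervisedMetrics.randomUMSE (f n) (y n) (a n) (b n) (c n)) (P n)))
      atTop (id : ℝ → ℝ) P (gaussianReal 0 1) := by
  obtain ⟨η, hη⟩ := hmom
  obtain ⟨γ, hγ⟩ := herr
  obtain ⟨δ, hδ, hnd⟩ := hnondeg
  have h6 {n : ℕ} {X : Ω n → ℝ} (hX : MemLp X 6 (P n)) (m : ℝ) :
      MemLp (fun ω ↦ X ω - m) 6 (P n) := hX.sub (memLp_const m)
  have ma (n i) := (hη n i).1.1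
  have mb (n i) := (hη n i).2.1.1
  have mc (n i) := (hη n i).2.2.1
  have sa (n i) : ∫ ω, (a n i ω - x n i) ^ 2 ∂(P n) = variance (a n i) (P n) :=
    UnsupervisedMetrics.integral_sub_sq_eq_variance (ma n i).aemeasurable (hcent n i).1.2
  have sb (n i) : ∫ ω, (b n i ω - x n i) ^ 2 ∂(P n) = ∫ ω, (a n i ω - x n i) ^ 2 ∂(P n) := by
    rw [sa, ← (hvar n i).1,
      UnsupervisedMetrics.integral_sub_sq_eq_variance (mb n i).aemeasurable (hcent n i).2.1.2]
  have sc (n i) : ∫ ω, (c n i ω - x n i) ^ 2 ∂(P n) = ∫ ω, (a n i ω - x n i) ^ 2 ∂(P n) := by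
    rw [sa, ← (hvar n i).2,
      UnsupervisedMetrics.integral_sub_sq_eq_variance (mc n i).aemeasurable (hcent n i).2.2.2]
  have za (n i) := UnsupervisedMetrics.integral_sub_eq_zero (hcent n i).1.1 (hcent n i).1.2
  have zb (n i) := UnsupervisedMetrics.integral_sub_eq_zero (hcent n i).2.1.1 (hcent n i).2.1.2
  have zc (n i) := UnsupervisedMetrics.integral_sub_eq_zero (hcent n i).2.2.1 (hcent n i).2.2.2
  let N (n : ℕ) := UnsupervisedMetrics.noise (f n) (x n) (y n) (a n) (b n) (c n)
  have hN3 (n i) : MemLp (N n i) 3 (P n) :=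
    UnsupervisedMetrics.memLp_entryNoise (h6 (ma n i) _) (h6 (mb n i) _) (h6 (mc n i) _)
  have hN2 (n i) : MemLp (N n i) 2 (P n) := (hN3 n i).mono_exponent (by norm_num)
  have hNind (n) : iIndepFun (N n) (P n) :=
    UnsupervisedMetrics.iIndepFun_noise (hindep n) (fun i ↦ (ma n i).aemeasurable)
      (fun i ↦ (mb n i).aemeasurable) fun i ↦ (mc n i).aemeasurable
  have hNvar (n i) : variance (a n i) (P n) ^ 2 ≤ variance (N n i) (P n) := by
    rw [← sa n i]
    exact UnsupervisedMetrics.sq_integral_sq_le_variance_entryNoise (h6 (ma n i) _)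
      (h6 (mb n i) _) (h6 (mc n i) _)
      (UnsupervisedMetrics.iIndepFun_centered_entry (hindep n) i)
      (za n i) (zb n i) (zc n i) (sb n i) (sc n i)
  have hN0 (n i) : ∫ ω, N n i ω ∂(P n) = 0 :=
    UnsupervisedMetrics.integral_entryNoise (h6 (ma n i) _) (h6 (mb n i) _) (h6 (mc n i) _)
      ((UnsupervisedMetrics.iIndepFun_centered_entry (hindep n) i).indepFun
        (i := 1) (j := 2) (by decide))
      (za n i) (zb n i) (sb n i) (sc n i)
  have hN3le (n i) : ∫ ω, |N n i ω| ^ 3 ∂(P n) ≤ 160 * η + 16 * γ ^ 6 :=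
    UnsupervisedMetrics.integral_abs_entryNoise_pow_three_le (h6 (ma n i) _)
      (h6 (mb n i) _) (h6 (mc n i) _)
      ((hη n i).1.integral_sub_pow_six_le (hcent n i).1.2)
      ((hη n i).2.1.integral_sub_pow_six_le (hcent n i).2.1.2)
      ((hη n i).2.2.integral_sub_pow_six_le (hcent n i).2.2.2) (hγ n i)
  have hlow : ∀ᶠ n : ℕ in atTop, n * δ ^ 2 ≤ ∑ i, variance (N n i) (P n) := by
    filter_upwards [hnd, eventually_gt_atTop 0] with n hn hn0
    have hn' : (0 : ℝ) < n := by exact_mod_cast hn0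
    have hsum : n * δ ≤ ∑ i, variance (a n i) (P n) := by
      rwa [one_div, inv_mul_eq_div, le_div_iff₀' hn'] at hn
    -- Cauchy–Schwarz turns the lower bound on the average of `σᵢ²` into one for `σᵢ⁴`: `(nδ)² ≤ (∑
    -- σᵢ²)² ≤ n ∑ σᵢ⁴`.
    have hcs := sq_sum_le_card_mul_sum_sq (s := Finset.univ) (f := fun i ↦ variance (a n i) (P n))
    rw [Finset.card_univ, Fintype.card_fin] at hcs
    have hsq := pow_le_pow_left₀ (by positivity) hsum 2
    have hle := Finset.sum_le_sum fun i (_ : i ∈ Finset.univ) ↦ hNvar n i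
    refine le_trans (le_of_mul_le_mul_left ?_ hn') hle
    calc (n : ℝ) * (n * δ ^ 2) = (n * δ) ^ 2 := by ring
      _ ≤ _ := hsq.trans hcs
  have hclt := tendstoInDistribution_sum_div_sqrt_sum_variance hN3 hN0 hNind
    (by
      filter_upwards [hlow, eventually_gt_atTop 0] with n hn hn0
      exact lt_of_lt_of_le (by positivity) hn)
    (tendsto_div_sqrt_pow_three_of_le (K := 160 * η + 16 * γ ^ 6) hδ
      (fun n ↦ Finset.sum_nonneg fun i _ ↦ integral_nonneg fun ω ↦ by positivity)
      (fun n ↦ (Finset.sum_le_sum fun i _ ↦ hN3le n i).trans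
        (by simp [mul_add])) hlow)
  exact hclt.congr
    (fun n ↦ ae_of_all _ fun ω ↦
      (UnsupervisedMetrics.normalized_randomUMSE_eq (hN2 n) (hNind n) ω).symm) .rfl
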